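/- Let $G$ be a connected and simply connected nilpotent (real, finite-dimensional) Lie group with Lie algebra $\mathfrak g$ and exponential map $\exp:\mathfrak g\to G$, and let $N\le G$ be a lattice, that is, a discrete subgroup such that the space $N\backslash G$ of cosets $Ng$ is compact. Let $p:G\to N\backslash G$, $p(g)=Ng$, be the projection. Let $N^{\mathbb Q}$ be the radicable hull (rational Mal'cev completion) of $N$ in $G$, i.e. $N^{\mathbb Q}=\exp(\mathfrak n^{\mathbb Q})$, where $\mathfrak n^{\mathbb Q}\subseteq\mathfrak g$ is the $\mathbb Q$-linear span of $\log N=\{X\in\mathfrak g : \exp X\in N\}$. Let $\delta$ be a continuous automorphism of $G$ with $\delta(N)\subseteq N$, and let $\bar\delta:N\backslash G\to N\backslash G$, $\bar\delta(Ng)=N\delta(g)$, be the induced nilmanifold endomorphism. Then every point of $p(N^{\mathbb Q})$ is eventually periodic for $\bar\delta$: $$p(N^{\mathbb Q})\subseteq \mathrm{ePer}(\bar\delta),$$ where $\mathrm{ePer}(\bar\delta)$ is the set of points $x$ such that, for some $k>0$, the point $y=\bar\delta^{\,k}(x)$ satisfies $\bar\delta^{\,m}(y)=y$ for some $m>0$.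 -/

import Mathlib

open scoped Manifold ContDiff

/-- A lattice of a topological group `G`: a discrete subgroup `N` such that the space `N \ G` of
cosets `N g`, with the quotient topology, is compact. -/
structure IsCocompactLattice {G : Type*} [Group G] [TopologicalSpace G] (N : Subgroup G) :
    Prop where
  discrete : DiscreteTopology N
  compact : CompactSpace (Quotient (QuotientGroup.rightRel N))

/-- The space `N \ G` of cosets `N g`, carrying the quotient topology. -/
abbrev Nilmanifold {G : Type*} [Group G] (N : Subgroup G) : Type _ :=
  Quotient (QuotientGroup.rightRel N)

/-- The projection `p : G → N \ G`, `g ↦ N g`. -/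
def nilProj {G : Type*} [Group G] (N : Subgroup G) (g : G) : Nilmanifold N :=
  Quotient.mk (QuotientGroup.rightRel N) g

/-- The self-map `N g ↦ N δ(g)` of `N \ G` induced by a continuous automorphism `δ` of `G`
with `δ(N) ≤ N`. -/
def nilEndomorphism {G : Type*} [Group G] [TopologicalSpace G] (N : Subgroup G) (δ : G ≃ₜ* G)
    (hδ : ∀ n ∈ N, δ n ∈ N) : Nilmanifold N → Nilmanifold N :=
  Quotient.map δ fun a b hab => by
    have h : b * a⁻¹ ∈ N := QuotientGroup.rightRel_apply.mp hab
    exact QuotientGroup.rightRel_apply.mpr (by simpa using hδ _ h)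

/-- The eventually periodic points of `f`: the points `x` such that `f^k(x)` is periodic for some
`k > 0`. -/
def ePer {X : Type*} (f : X → X) : Set X :=
  {x | ∃ k : ℕ, 0 < k ∧ f^[k] x ∈ Function.periodicPts f}

section LieGroup

variable {E : Type*} [NormedAddCommGroup E] [NormedSpace ℝ E]
  {H : Type*} [TopologicalSpace H] (I : ModelWithCorners ℝ E H)
  {G : Type*} [Group G] [TopologicalSpace G] [ChartedSpace H G]

/-- `IsLieExp I X g` says that `exp X = g`: the integral curve through `1` of the left-invariant
vector field of `X` takes the value `g` at time `1`. -/
def IsLieExp (X : GroupLieAlgebra I G) (g : G) : Prop :=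
  ∃ γ : ℝ → G, γ 0 = 1 ∧ IsMIntegralCurve (I := I) γ (mulInvariantVectorField X) ∧ γ 1 = g

/-- The set `log N` of all vectors `X` of the Lie algebra of `G` with `exp X ∈ N`. -/
def lieLog (N : Subgroup G) : Set (GroupLieAlgebra I G) :=
  {X | ∃ n ∈ N, IsLieExp I X n}

/-- The Lie algebra of a real Lie group as a vector space over `ℚ`. -/
@[reducible]
noncomputable def lieRatModule (G : Type*) [Group G] [TopologicalSpace G] [ChartedSpace H G] :
    Module ℚ (GroupLieAlgebra I G) :=
  Module.compHom _ (algebraMap ℚ ℝ)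

/-- The rational subspace of the Lie algebra of `G` spanned by `log N`. -/
noncomputable def rationalLieAlgebra (N : Subgroup G) : Set (GroupLieAlgebra I G) :=
  letI := lieRatModule I G
  (Submodule.span ℚ (lieLog I N) : Submodule ℚ (GroupLieAlgebra I G))

/-- The radicable hull (rational Mal'cev completion) `N^ℚ` of `N` in `G`: the image under `exp` of
the rational subspace spanned by `log N`. -/
def radicableHull (N : Subgroup G) : Set G :=
  {g | ∃ X ∈ rationalLieAlgebra I N, IsLieExp I X g}

end LieGroup

/-! If g^m lies in N, then so does δ(g)^m = δ(g^m). Hence the image in N\G of the set of m-th roots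
of elements of N is mapped into itself, and a point of a finite invariant set is eventually
periodic. Two facts remain. Every element of the hull has a positive power in N
(`radicableHull_subset_isolator`). The roots of N form a subgroup `isolator N`, and the sum of two
Lie algebra vectors is realised in the group by an explicit word, `nilpotentSum`, in their
one-parameter groups. This replaces the Baker-Campbell-Hausdorff formula. The image of the m-th
roots is finite (`finite_nilProj_image_roots`). By nilpotency one exponent M sends the whole group
generated by these roots into N. Since M-th powers detect 1 near 1, that group is discrete, and
compactness of N\G finishes. Both facts rest on `lowerCentralSeries_eq_pow`: iterated commutators of
weight k + 1 are multilinear modulo higher ones, so l-th powers of the entries give the power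
l^(k+1). -/

/-! ### Powers in nilpotent groups. -/

section NilpotentGroups

open scoped commutatorElement

variable {H D : Type*} [Group H] [Group D]

/-- The last nontrivial term of the lower central series is central. -/
theorem lowerCentralSeries_commute {n : ℕ}
    (hn : (⊤ : Subgroup H).lowerCentralSeries (n + 1) = ⊥) {z : H}
    (hz : z ∈ (⊤ : Subgroup H).lowerCentralSeries n) (h : H) : Commute z h := by
  rw [← commutatorElement_eq_one_iff_commute, ← Subgroup.mem_bot, ← hn]
  exact Subgroup.commutator_mem_commutator hz (Subgroup.mem_top h)

theorem lowerCentralSeries_map_mem (f : D →* H) {n : ℕ} {d : D}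
    (hd : d ∈ (⊤ : Subgroup D).lowerCentralSeries n) :
    f d ∈ (⊤ : Subgroup H).lowerCentralSeries n :=
  Subgroup.lowerCentralSeries_mono n le_top
    (Subgroup.map_lowerCentralSeries (S := ⊤) f n ▸ Subgroup.mem_map_of_mem f hd)

theorem lowerCentralSeries_quotient (n : ℕ) :
    (⊤ : Subgroup (H ⧸ (⊤ : Subgroup H).lowerCentralSeries n)).lowerCentralSeries n = ⊥ := by
  have h := Subgroup.map_lowerCentralSeries (S := (⊤ : Subgroup H))
    (QuotientGroup.mk' ((⊤ : Subgroup H).lowerCentralSeries n)) n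
  rw [Subgroup.map_top_of_surjective _ (QuotientGroup.mk'_surjective _)] at h
  rw [← h, QuotientGroup.map_mk'_self]

/-- If all commutators `⁅a, q⁆` are central, then `q ↦ ⁅a, q⁆` is a homomorphism. -/
def commutatorHom (a : H) (ha : ∀ q h : H, Commute ⁅a, q⁆ h) : H →* H where
  toFun q := ⁅a, q⁆
  map_one' := commutatorElement_one_right a
  map_mul' q r := by
    have e : ⁅a, q * r⁆ = ⁅a, q⁆ * (q * ⁅a, r⁆ * q⁻¹) := by simp only [commutatorElement_def]; group
    rw [e, ← (ha r q).eq, mul_inv_cancel_right]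

/-- A homomorphism with central values kills commutators. -/
theorem commutatorHom_eq_one {a : H} (ha : ∀ q h : H, Commute ⁅a, q⁆ h) {v : H}
    (hv : v ∈ (⊤ : Subgroup H).lowerCentralSeries 1) : ⁅a, v⁆ = 1 := by
  suffices (⊤ : Subgroup H).lowerCentralSeries 1 ≤ (commutatorHom a ha).ker from this hv
  rw [Subgroup.lowerCentralSeries_succ, Subgroup.commutator_le]
  intro s _ t _
  rw [MonoidHom.mem_ker, map_commutatorElement, commutatorElement_eq_one_iff_commute]
  exact ha s _

theorem commutatorElement_pow_left {a q : H} (ha : ∀ h : H, Commute ⁅a, q⁆ h) (i : ℕ) :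
    ⁅a ^ i, q⁆ = ⁅a, q⁆ ^ i := by
  induction i with
  | zero => simp
  | succ i ih =>
    have e : ⁅a * a ^ i, q⁆ = a * ⁅a ^ i, q⁆ * a⁻¹ * ⁅a, q⁆ := by
      simp only [commutatorElement_def]; group
    rw [pow_succ', e, ih, ← ((ha a).pow_left i).eq, mul_inv_cancel_right, pow_succ]

theorem commutatorElement_mul_left_of_central {a u q : H} (hu : ∀ h : H, Commute u h) :
    ⁅a * u, q⁆ = ⁅a, q⁆ := by
  have e : ⁅a * u, q⁆ = a * ((u * q) * u⁻¹) * a⁻¹ * q⁻¹ := by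
    simp only [commutatorElement_def]; group
  rw [e, (hu q).eq, mul_inv_cancel_right, commutatorElement_def]

/-- If two homomorphisms `f`, `g` satisfy `g = f ^ l` modulo commutators, then `g = f ^ l ^ (k + 1)`
on the `k`-th term of the lower central series, modulo the next term. -/
theorem lowerCentralSeries_eq_pow (l : ℕ) (k : ℕ) : ∀ {H : Type*} [Group H] (f g : D →* H),
    (⊤ : Subgroup H).lowerCentralSeries (k + 1) = ⊥ →
    (∀ d, ∃ u ∈ (⊤ : Subgroup H).lowerCentralSeries 1, g d = f d ^ l * u) →
    ∀ d ∈ (⊤ : Subgroup D).lowerCentralSeries k, g d = f d ^ l ^ (k + 1) := by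
  induction k with
  | zero =>
    intro H _ f g hH hfg d _
    obtain ⟨u, hu, h⟩ := hfg d
    rw [hH, Subgroup.mem_bot] at hu
    simpa [hu] using h
  | succ k ih =>
    intro H _ f g hH hfg d hd
    set Z := (⊤ : Subgroup H).lowerCentralSeries (k + 1) with hZ
    -- The induction hypothesis in `H ⧸ Z`; the error `u` is central because `Z` is the last term.
    have key : ∀ p ∈ (⊤ : Subgroup D).lowerCentralSeries k, ∃ u ∈ Z,
        g p = f p ^ l ^ (k + 1) * u := by
      intro p hp
      have h := ih ((QuotientGroup.mk' Z).comp f) ((QuotientGroup.mk' Z).comp g)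
        (lowerCentralSeries_quotient (k + 1)) (fun d => by
          obtain ⟨u, hu, h⟩ := hfg d
          exact ⟨QuotientGroup.mk' Z u, lowerCentralSeries_map_mem _ hu, by simp [h]⟩) p hp
      refine ⟨(f p ^ l ^ (k + 1))⁻¹ * g p, ?_, by group⟩
      exact QuotientGroup.eq.mp (by simpa using h.symm)
    have hc : ∀ p ∈ (⊤ : Subgroup D).lowerCentralSeries k, ∀ q h : H, Commute ⁅f p, q⁆ h := by
      intro p hp q h
      exact lowerCentralSeries_commute hH (Subgroup.commutator_mem_commutator
        (lowerCentralSeries_map_mem f hp) (Subgroup.mem_top q)) h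
    rw [Subgroup.lowerCentralSeries_succ, Subgroup.commutator_def] at hd
    have hcen : ∀ x, x ∈ Subgroup.closure {g | ∃ g₁ ∈ (⊤ : Subgroup D).lowerCentralSeries k,
        ∃ g₂ ∈ (⊤ : Subgroup D), ⁅g₁, g₂⁆ = g} → ∀ h, Commute (f x) h := fun x hx =>
      lowerCentralSeries_commute hH (lowerCentralSeries_map_mem f (n := k + 1) hx)
    induction hd using Subgroup.closure_induction with
    | mem x hx =>
      obtain ⟨p, hp, q, -, rfl⟩ := hx
      obtain ⟨u, hu, hpu⟩ := key p hp
      obtain ⟨v, hv, hqv⟩ := hfg q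
      -- The left entry contributes `l ^ (k + 1)` and the right entry one more factor `l`; both
      -- errors disappear.
      have h1 : ∀ r, ⁅f p ^ l ^ (k + 1) * u, r⁆ = ⁅f p, r⁆ ^ l ^ (k + 1) := fun r => by
        rw [commutatorElement_mul_left_of_central (lowerCentralSeries_commute hH hu),
          commutatorElement_pow_left (hc p hp r)]
      have h2 : ⁅f p, f q ^ l * v⁆ = ⁅f p, f q⁆ ^ l := by
        have := (commutatorHom (f p) (hc p hp)).map_mul (f q ^ l) v
        rw [map_pow] at this
        change ⁅f p, f q ^ l * v⁆ = ⁅f p, f q⁆ ^ l * ⁅f p, v⁆ at this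
        rw [this, commutatorHom_eq_one (hc p hp) hv, mul_one]
      rw [map_commutatorElement, map_commutatorElement, hpu, hqv, h1, h2, ← pow_mul, ← pow_succ']
    | one => simp
    | mul x y hx hy ihx ihy => rw [map_mul, map_mul, ihx, ihy, (hcen x hx _).mul_pow]
    | inv x hx ihx => rw [map_inv, map_inv, ihx, inv_pow]

theorem mk_eq_mk_iff_exists_lowerCentralSeries {n : ℕ} {a b : H} :
    (QuotientGroup.mk' ((⊤ : Subgroup H).lowerCentralSeries n) a =
      QuotientGroup.mk' ((⊤ : Subgroup H).lowerCentralSeries n) b) ↔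
    ∃ u ∈ (⊤ : Subgroup H).lowerCentralSeries n, b = a * u := by
  refine ⟨fun h => ⟨a⁻¹ * b, QuotientGroup.eq.mp h, by group⟩, ?_⟩
  rintro ⟨u, hu, rfl⟩
  exact QuotientGroup.eq.mpr (by simpa using hu)

/-- The pairs `(a, b)` such that `b = a ^ m` modulo commutators. -/
def powerRelation (H : Type*) [Group H] (m : ℕ) : Subgroup (H × H) :=
  MonoidHom.eqLocus (Abelianization.of.comp (MonoidHom.snd H H))
    ((powMonoidHom m).comp (Abelianization.of.comp (MonoidHom.fst H H)))

theorem mem_powerRelation {m : ℕ} {p : H × H} :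
    p ∈ powerRelation H m ↔ Abelianization.of p.2 = Abelianization.of p.1 ^ m :=
  Iff.rfl

theorem powerRelation_exists {m : ℕ} {p : H × H} (hp : p ∈ powerRelation H m) :
    ∃ u ∈ (⊤ : Subgroup H).lowerCentralSeries 1, p.2 = p.1 ^ m * u := by
  rw [mem_powerRelation, ← map_pow] at hp
  refine ⟨(p.1 ^ m)⁻¹ * p.2, ?_, by group⟩
  rw [Subgroup.top_lowerCentralSeries_one]
  exact QuotientGroup.eq.mp hp.symm

/-- Descent along the lower central series: raising to the power `m ^ (k + 1)` moves the error in
term `k` into `K`, up to an error in the next term. -/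
theorem pow_mem_mul_lowerCentralSeries {S : Set H} (hS : Subgroup.closure S = ⊤) (K : Subgroup H)
    {m : ℕ} (hm : ∀ s ∈ S, s ^ m ∈ K) (k : ℕ) (h : H) :
    ∃ b ∈ K, ∃ u ∈ (⊤ : Subgroup H).lowerCentralSeries k,
      h ^ (∏ i ∈ Finset.range k, m ^ (i + 1)) = b * u := by
  induction k with
  | zero => exact ⟨1, K.one_mem, h, Subgroup.mem_top h, by simp⟩
  | succ k ih =>
    obtain ⟨b, hb, u, hu, hbu⟩ := ih
    -- Pairs whose second entry lies in `K` and is the `m`-th power of the first modulo commutators.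
    -- Since `S` generates, `D` projects onto `H`, so `u` lifts to term `k` of the series of `D`;
    -- the second entry of the lift is the required element of `K`.
    let D : Subgroup (H × H) := powerRelation H m ⊓ K.comap (MonoidHom.snd H H)
    have hD : (⊤ : Subgroup D).map ((MonoidHom.fst H H).comp D.subtype) = ⊤ := by
      rw [eq_top_iff, ← hS, Subgroup.closure_le]
      intro s hs
      exact ⟨⟨(s, s ^ m), by simp [mem_powerRelation], hm s hs⟩, Subgroup.mem_top _, rfl⟩
    rw [← hD, ← Subgroup.map_lowerCentralSeries] at hu
    obtain ⟨d, hd, rfl⟩ := hu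
    let π := QuotientGroup.mk' ((⊤ : Subgroup H).lowerCentralSeries (k + 1))
    have h1 := lowerCentralSeries_eq_pow m k (π.comp ((MonoidHom.fst H H).comp D.subtype))
      (π.comp ((MonoidHom.snd H H).comp D.subtype)) (lowerCentralSeries_quotient (k + 1))
      (fun d => by
        obtain ⟨v, hv, h⟩ := powerRelation_exists d.2.1
        exact ⟨π v, lowerCentralSeries_map_mem _ hv,
          (congrArg π h).trans (by rw [map_mul, map_pow]; rfl)⟩) d hd
    -- `u` is central modulo the next term, so the power of `b * u` splits.
    have hc := lowerCentralSeries_commute (lowerCentralSeries_quotient (k + 1))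
      (lowerCentralSeries_map_mem (π.comp ((MonoidHom.fst H H).comp D.subtype)) hd) (π b)
    obtain ⟨v, hv, h2⟩ := mk_eq_mk_iff_exists_lowerCentralSeries (n := k + 1)
      (a := b ^ m ^ (k + 1) * d.1.2) (b := h ^ (∏ i ∈ Finset.range (k + 1), m ^ (i + 1))) |>.mp (by
        rw [Finset.prod_range_succ, pow_mul, hbu, map_pow, map_mul, map_mul, map_pow]
        refine Eq.trans ?_ (hc.symm.mul_pow _).symm
        exact congrArg _ h1)
    exact ⟨_, K.mul_mem (K.pow_mem hb _) d.2.2, v, hv, h2⟩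

/-- In a nilpotent group, if the `m`-th powers of some elements lie in a subgroup `K`, then so do
the `M`-th powers of all elements that they generate, with `M` independent of `K`. -/
theorem exists_pow_mem_of_mem_closure (H : Type*) [Group H] [Group.IsNilpotent H] {m : ℕ}
    (hm : 0 < m) : ∃ M : ℕ, 0 < M ∧ ∀ (K : Subgroup H) (S : Set H), (∀ s ∈ S, s ^ m ∈ K) →
      ∀ h ∈ Subgroup.closure S, h ^ M ∈ K := by
  obtain ⟨c, hc⟩ := Subgroup.nilpotent_iff_lowerCentralSeries.mp ‹Group.IsNilpotent H›
  refine ⟨∏ i ∈ Finset.range c, m ^ (i + 1), Finset.prod_pos fun i _ => pow_pos hm _, ?_⟩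
  intro K S hS h hh
  -- The descent takes place in the group generated by `S`, whose lower central series maps into
  -- that of `H`; hence `c` and the exponent do not depend on `S`.
  let f := (Subgroup.closure S).subtype
  obtain ⟨b, hb, u, hu, e⟩ := pow_mem_mul_lowerCentralSeries
    (Subgroup.closure_closure_coe_preimage (k := S)) (K.comap f) (m := m)
    (fun s hs => hS s hs) c ⟨h, hh⟩
  have hu' := lowerCentralSeries_map_mem f hu
  rw [hc, Subgroup.mem_bot] at hu'
  have := congrArg f e
  rw [map_mul, hu', mul_one, map_pow] at this
  exact this ▸ hb

/-- The elements of a nilpotent group with a positive power in `K` form a subgroup. -/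
def isolator [Group.IsNilpotent H] (K : Subgroup H) : Subgroup H where
  carrier := {h | ∃ m : ℕ, 0 < m ∧ h ^ m ∈ K}
  one_mem' := ⟨1, one_pos, by simp⟩
  inv_mem' := fun {h} ⟨m, hm, h'⟩ => ⟨m, hm, by simpa using h'⟩
  mul_mem' := fun {a b} ⟨m, hm, ha⟩ ⟨n, hn, hb⟩ => by
    obtain ⟨M, hM, h⟩ := exists_pow_mem_of_mem_closure H (Nat.mul_pos hm hn)
    refine ⟨M, hM, h K {a, b} ?_ _ (mul_mem (Subgroup.subset_closure (by simp))
      (Subgroup.subset_closure (by simp)))⟩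
    rintro s (rfl | rfl)
    · exact pow_mul s m n ▸ K.pow_mem ha n
    · exact mul_comm m n ▸ pow_mul s n m ▸ K.pow_mem hb m

/-! ### Lie algebra addition as a group word. -/

/-- A word in the values of `x` and `y`. For homomorphisms `x`, `y` from `ℚ` to a nilpotent group
of class at most `n + 1` it is a homomorphism in `t`, the sum of `x` and `y` in the sense of
Lie algebras. -/
def nilpotentSum {K : Type*} [Field K] (x y : K → H) : ℕ → K → H
  | 0, t => x t * y t
  -- The power `2 ^ (n + 2)` cancels the failure of additivity, of weight `n + 2`; the division
  -- restores the derivative at 0.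
  | n + 1, t => nilpotentSum x y n (t / (2 ^ (n + 2) - 2)) ^ (2 ^ (n + 2)) *
      (nilpotentSum x y n (2 * (t / (2 ^ (n + 2) - 2))))⁻¹

section nilpotentSum

variable {K : Type*} [Field K]

theorem map_nilpotentSum (φ : H →* D) (x y : K → H) (n : ℕ) (t : K) :
    φ (nilpotentSum x y n t) = nilpotentSum (fun s => φ (x s)) (fun s => φ (y s)) n t := by
  induction n generalizing t with
  | zero => simp [nilpotentSum]
  | succ n ih => simp [nilpotentSum, ih]

theorem nilpotentSum_comp_mul (x y : K → H) (n : ℕ) (a t : K) :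
    nilpotentSum (fun s => x (a * s)) (fun s => y (a * s)) n t = nilpotentSum x y n (a * t) := by
  induction n generalizing t with
  | zero => simp [nilpotentSum]
  | succ n ih => simp only [nilpotentSum, ih, mul_div_assoc, mul_left_comm a 2]

theorem nilpotentSum_map {L : Type*} [Field L] (i : K →+* L) (x y : L → H) (n : ℕ) (t : K) :
    nilpotentSum (fun s => x (i s)) (fun s => y (i s)) n t = nilpotentSum x y n (i t) := by
  induction n generalizing t with
  | zero => simp [nilpotentSum]
  | succ n ih => simp only [nilpotentSum, ih, map_mul, map_div₀, map_sub, map_pow, map_ofNat]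

theorem nilpotentSum_mem (A : Subgroup H) {x y : K → H} (hx : ∀ t, x t ∈ A) (hy : ∀ t, y t ∈ A)
    (n : ℕ) (t : K) : nilpotentSum x y n t ∈ A := by
  induction n generalizing t with
  | zero => exact A.mul_mem (hx t) (hy t)
  | succ n ih => exact A.mul_mem (A.pow_mem (ih _) _) (A.inv_mem (ih _))

end nilpotentSum

theorem map_intCast_mul_of_map_add {w : ℚ → H} (hw : ∀ s t, w (s + t) = w s * w t) (a : ℤ) (r : ℚ) :
    w (a * r) = w r ^ a := by
  let f : Multiplicative ℚ →* H := MonoidHom.mk' (fun t => w t.toAdd) fun s t => hw _ _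
  have := map_zpow f (Multiplicative.ofAdd r) a
  rw [← ofAdd_zsmul, zsmul_eq_mul] at this
  exact this

theorem exists_intCast_mul_eq (s t : ℚ) : ∃ (r : ℚ) (a b : ℤ), s = a * r ∧ t = b * r := by
  refine ⟨1 / (s.den * t.den), s.num * t.den, t.num * s.den, ?_, ?_⟩
  · have := s.den_nz
    have := t.den_nz
    conv_lhs => rw [← s.num_div_den]
    push_cast
    field_simp
  · have := s.den_nz
    have := t.den_nz
    conv_lhs => rw [← t.num_div_den]
    push_cast
    field_simp

/-- A map from `ℚ` that is a homomorphism modulo a central subgroup has commuting values. -/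
theorem commute_of_map_add_central {n : ℕ} (hn : (⊤ : Subgroup H).lowerCentralSeries (n + 1) = ⊥)
    {w : ℚ → H} (hw : ∀ s t, QuotientGroup.mk' ((⊤ : Subgroup H).lowerCentralSeries n) (w (s + t)) =
      QuotientGroup.mk' _ (w s) * QuotientGroup.mk' _ (w t)) (s t : ℚ) : Commute (w s) (w t) := by
  obtain ⟨r, a, b, rfl, rfl⟩ := exists_intCast_mul_eq s t
  have key : ∀ a : ℤ, ∃ u : H, (∀ h, Commute u h) ∧ w (a * r) = w r ^ a * u := by
    intro a
    have := map_intCast_mul_of_map_add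
      (w := fun t => QuotientGroup.mk' ((⊤ : Subgroup H).lowerCentralSeries n) (w t)) hw a r
    rw [← map_zpow] at this
    obtain ⟨u, hu, h⟩ := mk_eq_mk_iff_exists_lowerCentralSeries.mp this.symm
    exact ⟨u, lowerCentralSeries_commute hn hu, h⟩
  obtain ⟨u, hu, h⟩ := key a
  obtain ⟨v, hv, h'⟩ := key b
  rw [h, h']
  exact Commute.mul_left (((Commute.refl _).zpow_zpow a b).mul_right (hv _).symm) (hu _)

/-- Here `a`, `b`, `c` stand for the values of a word at `s`, `t`, `s + t`, and the primed letters
for those at the doubled arguments. If doubling raises the additivity defect to the power `e`, the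
combination `c ^ e * c'⁻¹` has no defect. -/
theorem mul_inv_eq_of_defect {A : Type*} [CommGroup A] {a b c a' b' c' : A} {e : ℕ}
    (h : a' * b' * c'⁻¹ = (a * b * c⁻¹) ^ e) :
    c ^ e * c'⁻¹ = (a ^ e * a'⁻¹) * (b ^ e * b'⁻¹) := by
  have h' : c'⁻¹ = b'⁻¹ * a'⁻¹ * (a ^ e * b ^ e * (c ^ e)⁻¹) := by
    rw [← inv_pow, ← mul_pow, ← mul_pow, ← h]
    group
  rw [h', mul_left_comm (c ^ e), mul_left_comm (c ^ e), mul_inv_cancel, mul_one]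
  simp only [mul_comm, mul_left_comm, mul_assoc]

/-- Modulo the last, central term, the previous word `w` is additive by induction. Its defect lies
in that term, of weight `n + 2`, so doubling the arguments raises it to the power `2 ^ (n + 2)`. -/
theorem nilpotentSum_add (n : ℕ) : ∀ {H : Type*} [Group H],
    (⊤ : Subgroup H).lowerCentralSeries (n + 1) = ⊥ → ∀ {x y : ℚ → H},
    (∀ s t, x (s + t) = x s * x t) → (∀ s t, y (s + t) = y s * y t) →
    ∀ s t, nilpotentSum x y n (s + t) = nilpotentSum x y n s * nilpotentSum x y n t := by
  induction n with
  | zero =>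
    intro H _ hH x y hx hy s t
    have := lowerCentralSeries_commute hH (Subgroup.mem_top (y s)) (x t)
    simp only [nilpotentSum, hx, hy]
    rw [mul_assoc, mul_assoc, ← mul_assoc (x t), ← this.eq, mul_assoc]
  | succ n ih =>
    intro H _ hH x y hx hy
    -- Stated for an arbitrary group because it is needed both in `H` and in the group `D` of pairs
    -- below.
    have hmod : ∀ {A : Type _} [Group A] {x y : ℚ → A}, (∀ s t, x (s + t) = x s * x t) →
        (∀ s t, y (s + t) = y s * y t) → ∀ s t,
        QuotientGroup.mk' ((⊤ : Subgroup A).lowerCentralSeries (n + 1))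
          (nilpotentSum x y n (s + t)) = QuotientGroup.mk' _ (nilpotentSum x y n s) *
            QuotientGroup.mk' _ (nilpotentSum x y n t) := by
      intro A _ x y hx hy s t
      rw [map_nilpotentSum, map_nilpotentSum, map_nilpotentSum]
      exact ih (lowerCentralSeries_quotient (n + 1)) (fun s t => by rw [hx, map_mul])
        (fun s t => by rw [hy, map_mul]) s t
    set w := nilpotentSum x y n with hw
    have hcomm : ∀ s t, Commute (w s) (w t) := commute_of_map_add_central hH (hmod hx hy)
    have hdef : ∀ s t, w (2 * s) * w (2 * t) * (w (2 * (s + t)))⁻¹ =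
        (w s * w t * (w (s + t))⁻¹) ^ 2 ^ (n + 2) := by
      intro s t
      -- As `x (2 * t) = x t ^ 2`, the pairs `(x t, x (2 * t))` lie in `D`. The defect formed in `D`
      -- has as entries the defects of `w` at the given and at the doubled arguments, and
      -- `lowerCentralSeries_eq_pow` compares them.
      let D := powerRelation H 2
      have hrel : ∀ {z : ℚ → H}, (∀ s t, z (s + t) = z s * z t) → ∀ t, (z t, z (2 * t)) ∈ D := by
        intro z hz t
        rw [mem_powerRelation, two_mul, hz, map_mul, pow_two]
      let xD : ℚ → D := fun t => ⟨(x t, x (2 * t)), hrel hx t⟩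
      let yD : ℚ → D := fun t => ⟨(y t, y (2 * t)), hrel hy t⟩
      have hxD : ∀ s t, xD (s + t) = xD s * xD t := fun s t =>
        Subtype.ext (Prod.ext (hx _ _) ((congrArg x (mul_add _ _ _)).trans (hx _ _)))
      have hyD : ∀ s t, yD (s + t) = yD s * yD t := fun s t =>
        Subtype.ext (Prod.ext (hy _ _) ((congrArg y (mul_add _ _ _)).trans (hy _ _)))
      let f := (MonoidHom.fst H H).comp D.subtype
      let g := (MonoidHom.snd H H).comp D.subtype
      have hf : ∀ t, f (nilpotentSum xD yD n t) = w t := fun t => map_nilpotentSum f xD yD n t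
      have hg : ∀ t, g (nilpotentSum xD yD n t) = w (2 * t) := fun t =>
        (map_nilpotentSum g xD yD n t).trans (nilpotentSum_comp_mul x y n 2 t)
      have hmem : nilpotentSum xD yD n s * nilpotentSum xD yD n t *
          (nilpotentSum xD yD n (s + t))⁻¹ ∈ (⊤ : Subgroup D).lowerCentralSeries (n + 1) := by
        rw [← QuotientGroup.eq_one_iff]
        have := hmod hxD hyD s t
        change QuotientGroup.mk' _ _ = 1
        rw [map_mul, map_inv, map_mul, ← this, mul_inv_cancel]
      have := lowerCentralSeries_eq_pow 2 (n + 1) f g hH (fun d => powerRelation_exists d.2) _ hmem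
      simpa only [map_mul, map_inv, hf, hg] using this
    have hv : ∀ s t, w (s + t) ^ 2 ^ (n + 2) * (w (2 * (s + t)))⁻¹ =
        (w s ^ 2 ^ (n + 2) * (w (2 * s))⁻¹) * (w t ^ 2 ^ (n + 2) * (w (2 * t))⁻¹) := by
      intro s t
      have : IsMulCommutative (Subgroup.closure (Set.range w)) :=
        Subgroup.isMulCommutative_closure (by
          rintro _ ⟨s, rfl⟩ _ ⟨t, rfl⟩
          exact hcomm s t)
      let _ : CommGroup (Subgroup.closure (Set.range w)) :=
        { (inferInstance : Group (Subgroup.closure (Set.range w))) with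
          mul_comm := this.is_comm.comm }
      let v : ℚ → Subgroup.closure (Set.range w) := fun t =>
        ⟨w t, Subgroup.subset_closure ⟨t, rfl⟩⟩
      exact congrArg Subtype.val (mul_inv_eq_of_defect (a := v s) (b := v t) (c := v (s + t))
        (a' := v (2 * s)) (b' := v (2 * t)) (c' := v (2 * (s + t))) (Subtype.ext (hdef s t)))
    intro s t
    simp only [nilpotentSum]
    rw [add_div]
    exact hv _ _

end NilpotentGroups

/-! ### One-parameter groups and derivatives at the identity. -/

section LieGroups

variable {E : Type*} [NormedAddCommGroup E] [NormedSpace ℝ E]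
  {G : Type*} [Group G] [TopologicalSpace G] [ChartedSpace E G]
  {F : Type*} [NormedAddCommGroup F] [NormedSpace ℝ F]
  {M : Type*} [TopologicalSpace M] [ChartedSpace F M]

/-- The map `f` takes the value `1` at `x` and has the derivative `f'` there. -/
def HasDerivAtOne (f : M → G) (x : M) (f' : F →L[ℝ] E) : Prop :=
  f x = 1 ∧ HasMFDerivAt 𝓘(ℝ, F) 𝓘(ℝ, E) f x f'

theorem HasDerivAtOne.unique {f : M → G} {x : M} {f' g' : F →L[ℝ] E} (hf : HasDerivAtOne f x f')
    (hg : HasDerivAtOne f x g') : f' = g' :=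
  hasMFDerivAt_unique hf.2 hg.2

theorem HasDerivAtOne.comp_mul {f : ℝ → G} {f' : ℝ →L[ℝ] E} (hf : HasDerivAtOne f 0 f') (a : ℝ) :
    HasDerivAtOne (fun t => f (a * t)) 0 (a • f') := by
  refine ⟨by simpa using hf.1, ?_⟩
  have h : HasMFDerivAt 𝓘(ℝ, ℝ) 𝓘(ℝ, ℝ) (fun t : ℝ => a * t) 0 (a • ContinuousLinearMap.id ℝ ℝ) :=
    ((hasFDerivAt_id (0 : ℝ)).const_smul a).hasMFDerivAt
  have hf' : HasMFDerivAt 𝓘(ℝ, ℝ) 𝓘(ℝ, E) f (a * 0) f' := by rw [mul_zero]; exact hf.2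
  refine (hf'.comp (0 : ℝ) h).congr_mfderiv (ContinuousLinearMap.ext fun (v : ℝ) => ?_)
  exact map_smul f' a v

/-- The one-parameter group of `X`. -/
def IsOneParameter (γ : ℝ → G) (X : GroupLieAlgebra 𝓘(ℝ, E) G) : Prop :=
  γ 0 = 1 ∧ IsMIntegralCurve (I := 𝓘(ℝ, E)) γ (mulInvariantVectorField X)

theorem mulInvariantVectorField_one (X : GroupLieAlgebra 𝓘(ℝ, E) G) :
    (mulInvariantVectorField X (1 : G) : E) = X := by
  have h : HasMFDerivAt 𝓘(ℝ, E) 𝓘(ℝ, E) (fun z : G => 1 * z) 1 (ContinuousLinearMap.id ℝ E) :=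
    (hasMFDerivAt_id 1).congr_of_eventuallyEq (.of_forall one_mul)
  exact DFunLike.congr_fun h.mfderiv X

theorem IsOneParameter.hasDerivAtOne {γ : ℝ → G} {X : GroupLieAlgebra 𝓘(ℝ, E) G}
    (h : IsOneParameter γ X) :
    HasDerivAtOne γ 0 ((1 : ℝ →L[ℝ] ℝ).smulRight (X : E) : ℝ →L[ℝ] E) := by
  refine ⟨h.1, ?_⟩
  have e : (mulInvariantVectorField X (γ 0) : E) = X := by
    rw [h.1]; exact mulInvariantVectorField_one X
  refine (h.2 0).congr_mfderiv (ContinuousLinearMap.ext fun (v : ℝ) => ?_)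
  exact congrArg (fun w : E => v • w) e

variable [LieGroup 𝓘(ℝ, E) ∞ G]

theorem hasMFDerivAt_mul_one_one :
    HasMFDerivAt (𝓘(ℝ, E).prod 𝓘(ℝ, E)) 𝓘(ℝ, E) (fun p : G × G => p.1 * p.2) (1, 1)
      (ContinuousLinearMap.fst ℝ E E + ContinuousLinearMap.snd ℝ E E : E × E →L[ℝ] E) := by
  have h : MDifferentiableAt (𝓘(ℝ, E).prod 𝓘(ℝ, E)) 𝓘(ℝ, E) (fun p : G × G => p.1 * p.2) (1, 1) :=
    (contMDiff_mul 𝓘(ℝ, E) ∞).mdifferentiableAt (by simp)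
  refine h.hasMFDerivAt.congr_mfderiv (ContinuousLinearMap.ext fun v => ?_)
  refine (mfderiv_prod_eq_add_apply h).trans ?_
  have h1 : HasMFDerivAt 𝓘(ℝ, E) 𝓘(ℝ, E) (fun z : G => z * 1) 1 (ContinuousLinearMap.id ℝ E) :=
    (hasMFDerivAt_id 1).congr_of_eventuallyEq (.of_forall mul_one)
  have h2 : HasMFDerivAt 𝓘(ℝ, E) 𝓘(ℝ, E) (fun z : G => 1 * z) 1 (ContinuousLinearMap.id ℝ E) :=
    (hasMFDerivAt_id 1).congr_of_eventuallyEq (.of_forall one_mul)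
  exact congrArg₂ (fun a b : E => a + b) (DFunLike.congr_fun h1.mfderiv v.1)
    (DFunLike.congr_fun h2.mfderiv v.2)

theorem HasDerivAtOne.mul {f g : M → G} {x : M} {f' g' : F →L[ℝ] E} (hf : HasDerivAtOne f x f')
    (hg : HasDerivAtOne g x g') : HasDerivAtOne (fun y => f y * g y) x (f' + g') := by
  refine ⟨by simp only [hf.1, hg.1, mul_one], ?_⟩
  have h := hf.2.prodMk hg.2
  have hm := hasMFDerivAt_mul_one_one (E := E) (G := G)
  have hm' : HasMFDerivAt (𝓘(ℝ, E).prod 𝓘(ℝ, E)) 𝓘(ℝ, E) (fun p : G × G => p.1 * p.2) (f x, g x)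
      (ContinuousLinearMap.fst ℝ E E + ContinuousLinearMap.snd ℝ E E : E × E →L[ℝ] E) := by
    rw [hf.1, hg.1]; exact hm
  exact hm'.comp x h

theorem HasDerivAtOne.inv {f : M → G} {x : M} {f' : F →L[ℝ] E} (hf : HasDerivAtOne f x f') :
    HasDerivAtOne (fun y => (f y)⁻¹) x (-f') := by
  have h : MDifferentiableAt 𝓘(ℝ, F) 𝓘(ℝ, E) (fun y => (f y)⁻¹) x :=
    ((contMDiff_inv 𝓘(ℝ, E) ∞).mdifferentiableAt (by simp)).comp x hf.2.mdifferentiableAt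
  obtain ⟨g', hg'⟩ : ∃ g' : F →L[ℝ] E, HasDerivAtOne (fun y => (f y)⁻¹) x g' :=
    ⟨_, by simp only [hf.1, inv_one], h.hasMFDerivAt⟩
  -- Differentiating `f y * (f y)⁻¹ = 1` determines the derivative of the inverse.
  have h1 := hf.mul hg'
  simp only [mul_inv_cancel] at h1
  have h2 : f' + g' = 0 := h1.unique ⟨rfl, hasMFDerivAt_const _ _⟩
  rw [neg_eq_of_add_eq_zero_right h2]
  exact hg'

theorem HasDerivAtOne.pow {f : M → G} {x : M} {f' : F →L[ℝ] E} (hf : HasDerivAtOne f x f') (n : ℕ) :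
    HasDerivAtOne (fun y => f y ^ n) x (n • f') := by
  induction n with
  | zero => simpa using ⟨rfl, hasMFDerivAt_const _ _⟩
  | succ n ih => simpa only [pow_succ, succ_nsmul] using ih.mul hf

theorem hasDerivAtOne_nilpotentSum {x y : ℝ → G} {x' y' : ℝ →L[ℝ] E} (hx : HasDerivAtOne x 0 x')
    (hy : HasDerivAtOne y 0 y') (n : ℕ) : HasDerivAtOne (nilpotentSum x y n) 0 (x' + y') := by
  induction n with
  | zero => exact hx.mul hy
  | succ n ih =>
    have h1 := (ih.comp_mul ((2 : ℝ) ^ (n + 2) - 2)⁻¹).pow (2 ^ (n + 2))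
    have h2 := (ih.comp_mul (2 * ((2 : ℝ) ^ (n + 2) - 2)⁻¹)).inv
    have h3 := h1.mul h2
    have hM : (2 : ℝ) ^ (n + 2) - 2 ≠ 0 := by
      have : (1 : ℝ) ≤ 2 ^ n := one_le_pow₀ (by norm_num)
      rw [pow_add]; linarith
    convert! h3 using 1
    · ext t
      simp only [nilpotentSum, div_eq_inv_mul, mul_assoc]
    · rw [← sub_eq_add_neg, ← Nat.cast_smul_eq_nsmul ℝ, smul_smul, ← sub_smul, ← sub_mul]
      push_cast
      rw [mul_inv_cancel₀ hM, one_smul]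

theorem contMDiff_one_mulInvariantVectorField (X : GroupLieAlgebra 𝓘(ℝ, E) G) :
    ContMDiff 𝓘(ℝ, E) 𝓘(ℝ, E).tangent 1
      (fun g => (⟨g, mulInvariantVectorField X g⟩ : TangentBundle 𝓘(ℝ, E) G)) := by
  have : LieGroup 𝓘(ℝ, E) (minSmoothness ℝ 3) G := by
    rw [minSmoothness_of_isRCLikeNormedField]
    exact LieGroup.of_le (n := ∞) (by norm_cast)
  exact (contMDiff_mulInvariantVectorField X).of_le (by
    rw [minSmoothness_of_isRCLikeNormedField]; norm_num)

theorem mdifferentiableAt_mul_left_group (a b : G) :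
    MDifferentiableAt 𝓘(ℝ, E) 𝓘(ℝ, E) (fun x => a * x) b :=
  (contMDiff_mul_left (n := ∞)).mdifferentiableAt (by simp)

theorem mfderiv_mulInvariantVectorField (X : GroupLieAlgebra 𝓘(ℝ, E) G) (a b : G) :
    (mfderiv 𝓘(ℝ, E) 𝓘(ℝ, E) (fun x => a * x) b : E →L[ℝ] E) (mulInvariantVectorField X b : E) =
      (mulInvariantVectorField X (a * b) : E) := by
  have e : (fun x : G => a * b * x) = (fun x => a * x) ∘ (fun x => b * x) :=
    funext fun x => mul_assoc _ _ _
  have h := mfderiv_comp_of_eq (mdifferentiableAt_mul_left_group (E := E) a b)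
    (mdifferentiableAt_mul_left_group b 1) (mul_one b)
  have key : (mfderiv 𝓘(ℝ, E) 𝓘(ℝ, E) (fun x => a * b * x) 1 : E →L[ℝ] E) =
      (mfderiv 𝓘(ℝ, E) 𝓘(ℝ, E) (fun x => a * x) b : E →L[ℝ] E).comp
        (mfderiv 𝓘(ℝ, E) 𝓘(ℝ, E) (fun x => b * x) 1 : E →L[ℝ] E) := by
    have hb : (mfderiv 𝓘(ℝ, E) 𝓘(ℝ, E) (fun x => a * x) (b * 1) : E →L[ℝ] E) =
        mfderiv 𝓘(ℝ, E) 𝓘(ℝ, E) (fun x => a * x) b := by rw [mul_one]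
    rw [e]
    exact h.trans (congrArg (fun A : E →L[ℝ] E => A.comp
      (mfderiv 𝓘(ℝ, E) 𝓘(ℝ, E) (fun x => b * x) 1 : E →L[ℝ] E)) hb)
  exact (DFunLike.congr_fun key (X : E)).symm

theorem IsMIntegralCurve.mul_left {γ : ℝ → G} {X : GroupLieAlgebra 𝓘(ℝ, E) G}
    (h : IsMIntegralCurve (I := 𝓘(ℝ, E)) γ (mulInvariantVectorField X)) (g : G) :
    IsMIntegralCurve (I := 𝓘(ℝ, E)) (fun t => g * γ t) (mulInvariantVectorField X) := by
  intro t
  refine ((mdifferentiableAt_mul_left_group g (γ t)).hasMFDerivAt.comp t (h t)).congr_mfderiv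
    (ContinuousLinearMap.ext fun (v : ℝ) => ?_)
  refine (map_smul (mfderiv 𝓘(ℝ, E) 𝓘(ℝ, E) (fun x => g * x) (γ t) : E →L[ℝ] E) v
    (mulInvariantVectorField X (γ t) : E)).trans ?_
  exact congrArg (fun w : E => v • w) (mfderiv_mulInvariantVectorField X g (γ t))

/-- Near `t` the curve is the left translate by `γ t` of its germ at 0. -/
theorem isOneParameter_of_hasDerivAtOne {γ : ℝ → G} {X : GroupLieAlgebra 𝓘(ℝ, E) G}
    (hγ : ∀ s t, γ (s + t) = γ s * γ t)
    (h : HasDerivAtOne γ 0 ((1 : ℝ →L[ℝ] ℝ).smulRight (X : E) : ℝ →L[ℝ] E)) :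
    IsOneParameter γ X := by
  refine ⟨h.1, fun t => ?_⟩
  have h1 : HasMFDerivAt 𝓘(ℝ, ℝ) 𝓘(ℝ, ℝ) (fun s : ℝ => s - t) t (ContinuousLinearMap.id ℝ ℝ) :=
    ((hasFDerivAt_id t).sub_const t).hasMFDerivAt
  have h2 : HasMFDerivAt 𝓘(ℝ, ℝ) 𝓘(ℝ, E) γ (t - t)
      ((1 : ℝ →L[ℝ] ℝ).smulRight (X : E) : ℝ →L[ℝ] E) := by rw [sub_self]; exact h.2
  have h3 : HasMFDerivAt 𝓘(ℝ, E) 𝓘(ℝ, E) (fun x => γ t * x) (γ (t - t))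
      (mfderiv 𝓘(ℝ, E) 𝓘(ℝ, E) (fun x => γ t * x) 1 : E →L[ℝ] E) := by
    rw [sub_self, h.1]
    exact (mdifferentiableAt_mul_left_group (γ t) 1).hasMFDerivAt
  have e : (fun x => γ t * x) ∘ γ ∘ (fun s : ℝ => s - t) = γ := funext fun s => by
    simp [← hγ]
  have h4 := h3.comp t (HasMFDerivAt.comp (f := fun s : ℝ => s - t) t h2 h1)
  rw [e] at h4
  refine h4.congr_mfderiv (ContinuousLinearMap.ext fun (v : ℝ) => ?_)
  exact map_smul (mfderiv 𝓘(ℝ, E) 𝓘(ℝ, E) (fun x => γ t * x) 1 : E →L[ℝ] E) v (X : E)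

variable [T2Space G]

theorem IsOneParameter.unique {γ γ' : ℝ → G} {X : GroupLieAlgebra 𝓘(ℝ, E) G}
    (h : IsOneParameter γ X) (h' : IsOneParameter γ' X) : γ = γ' :=
  isMIntegralCurve_Ioo_eq_of_contMDiff_boundaryless (t₀ := 0)
    (contMDiff_one_mulInvariantVectorField X) h.2 h'.2 (h.1.trans h'.1.symm)

/-- Both sides, as functions of `t`, are integral curves through `γ s`. -/
theorem IsOneParameter.add {γ : ℝ → G} {X : GroupLieAlgebra 𝓘(ℝ, E) G}
    (h : IsOneParameter γ X) (s t : ℝ) : γ (s + t) = γ s * γ t := by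
  have h1 := h.2.comp_add s
  have h2 := IsMIntegralCurve.mul_left h.2 (γ s)
  have := isMIntegralCurve_Ioo_eq_of_contMDiff_boundaryless (t₀ := 0)
    (contMDiff_one_mulInvariantVectorField X) h1 h2 (by simp [h.1])
  rw [add_comm]
  exact congrFun this t

end LieGroups

/-! ### Elements of the hull have powers in N. -/

section Hull

variable {E : Type*} [NormedAddCommGroup E] [NormedSpace ℝ E]
  {G : Type*} [Group G] [TopologicalSpace G] [ChartedSpace E G] [LieGroup 𝓘(ℝ, E) ∞ G]

theorem smulRight_one_add {E : Type*} [NormedAddCommGroup E] [NormedSpace ℝ E] (v w : E) :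
    (1 : ℝ →L[ℝ] ℝ).smulRight v + (1 : ℝ →L[ℝ] ℝ).smulRight w =
      (1 : ℝ →L[ℝ] ℝ).smulRight (v + w) := by
  ext; simp

theorem smulRight_one_smul {E : Type*} [NormedAddCommGroup E] [NormedSpace ℝ E] (a : ℝ) (v : E) :
    a • (1 : ℝ →L[ℝ] ℝ).smulRight v = (1 : ℝ →L[ℝ] ℝ).smulRight (a • v) := by
  ext; simp

theorem isOneParameter_zero : IsOneParameter (fun _ : ℝ => (1 : G))
    (0 : GroupLieAlgebra 𝓘(ℝ, E) G) := by
  refine isOneParameter_of_hasDerivAtOne (fun _ _ => (mul_one 1).symm) ⟨rfl, ?_⟩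
  refine (hasMFDerivAt_const (1 : G) (0 : ℝ)).congr_mfderiv ?_
  exact (ContinuousLinearMap.ext fun (v : ℝ) => (smul_zero v).symm :
    (0 : ℝ →L[ℝ] E) = (1 : ℝ →L[ℝ] ℝ).smulRight (0 : E))

theorem continuous_nilpotentSum {A : Type*} [Group A] [TopologicalSpace A] [IsTopologicalGroup A]
    {x y : ℝ → A} (hx : Continuous x) (hy : Continuous y) (n : ℕ) :
    Continuous (nilpotentSum x y n) := by
  induction n with
  | zero => exact hx.mul hy
  | succ n ih =>
    exact ((ih.comp (continuous_id.div_const _)).pow _).mul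
      (ih.comp (continuous_const.mul (continuous_id.div_const _))).inv

/-- The algebraic argument needs commensurable arguments; continuity and density of `ℚ` extend it.
-/
theorem nilpotentSum_add_real {A : Type*} [Group A] [TopologicalSpace A] [IsTopologicalGroup A]
    [T2Space A] {n : ℕ} (hn : (⊤ : Subgroup A).lowerCentralSeries (n + 1) = ⊥)
    {x y : ℝ → A} (hx : Continuous x) (hy : Continuous y) (hx' : ∀ s t, x (s + t) = x s * x t)
    (hy' : ∀ s t, y (s + t) = y s * y t) (s t : ℝ) :
    nilpotentSum x y n (s + t) = nilpotentSum x y n s * nilpotentSum x y n t := by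
  have hc := continuous_nilpotentSum hx hy n
  have hd : DenseRange (Prod.map ((↑) : ℚ → ℝ) ((↑) : ℚ → ℝ)) :=
    Rat.denseRange_cast.prodMap Rat.denseRange_cast
  have h := hd.equalizer (hc.comp (continuous_fst.add continuous_snd))
    ((hc.comp continuous_fst).mul (hc.comp continuous_snd)) (by
      refine funext fun ⟨p, q⟩ => ?_
      have := nilpotentSum_add n hn (x := fun q : ℚ => x (Rat.castHom ℝ q))
        (y := fun q : ℚ => y (Rat.castHom ℝ q)) (fun s t => by rw [map_add, hx'])
        (fun s t => by rw [map_add, hy']) p q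
      rw [nilpotentSum_map, nilpotentSum_map, nilpotentSum_map, map_add] at this
      exact this)
  exact congrFun h (s, t)

variable [T2Space G]

theorem IsOneParameter.nilpotentSum {n : ℕ}
    (hn : (⊤ : Subgroup G).lowerCentralSeries (n + 1) = ⊥) {x y : ℝ → G}
    {X Y : GroupLieAlgebra 𝓘(ℝ, E) G} (hx : IsOneParameter x X) (hy : IsOneParameter y Y) :
    IsOneParameter (nilpotentSum x y n) (X + Y) := by
  have : IsTopologicalGroup G := topologicalGroup_of_lieGroup 𝓘(ℝ, E) ∞
  refine isOneParameter_of_hasDerivAtOne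
    (nilpotentSum_add_real hn hx.2.continuous hy.2.continuous hx.add hy.add) ?_
  have h := hasDerivAtOne_nilpotentSum hx.hasDerivAtOne hy.hasDerivAtOne n
  exact smulRight_one_add (E := E) X Y ▸ h

theorem IsOneParameter.smul {x : ℝ → G} {X : GroupLieAlgebra 𝓘(ℝ, E) G} (hx : IsOneParameter x X)
    (a : ℝ) : IsOneParameter (fun t => x (a * t)) (a • X) := by
  refine isOneParameter_of_hasDerivAtOne (fun s t => by rw [mul_add, hx.add]) ?_
  have h := hx.hasDerivAtOne.comp_mul a
  exact smulRight_one_smul (E := E) a X ▸ h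

/-- Asking for all rational times, not just time 1, makes the property stable under rational scaling
and under the word for the sum. -/
theorem exists_isOneParameter_of_mem_rationalLieAlgebra [Group.IsNilpotent G] (N : Subgroup G)
    {X : GroupLieAlgebra 𝓘(ℝ, E) G} (hX : X ∈ rationalLieAlgebra 𝓘(ℝ, E) N) :
    ∃ x : ℝ → G, IsOneParameter x X ∧ ∀ q : ℚ, x q ∈ isolator N := by
  let _ := lieRatModule 𝓘(ℝ, E) G
  obtain ⟨n, hn⟩ := Subgroup.nilpotent_iff_lowerCentralSeries.mp ‹Group.IsNilpotent G›
  have hn' : (⊤ : Subgroup G).lowerCentralSeries (n + 1) = ⊥ :=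
    eq_bot_iff.mpr (hn ▸ Subgroup.lowerCentralSeries_antitone _ n.le_succ)
  change X ∈ Submodule.span ℚ (lieLog 𝓘(ℝ, E) N) at hX
  induction hX using Submodule.span_induction with
  | mem X hX =>
    obtain ⟨g, hg, x, h0, hx, rfl⟩ := hX
    have hx : IsOneParameter x X := ⟨h0, hx⟩
    -- The power `q.den` of `x q` is `x 1 ^ q.num`, and `x 1` lies in `N`.
    refine ⟨x, hx, fun q => ⟨q.den, q.den_pos, ?_⟩⟩
    have h := map_intCast_mul_of_map_add (w := fun q : ℚ => x q)
      (fun s t => by rw [Rat.cast_add, hx.add])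
    have h1 := h q.den q
    have h2 := h q.num 1
    rw [mul_one] at h2
    rw [Int.cast_natCast, Rat.den_mul_eq_num, h2, zpow_natCast] at h1
    rw [← h1]
    exact N.zpow_mem (by simpa using hg) _
  | zero => exact ⟨_, isOneParameter_zero, fun _ => one_mem _⟩
  | add X Y _ _ hX hY =>
    obtain ⟨x, hx, hxN⟩ := hX
    obtain ⟨y, hy, hyN⟩ := hY
    refine ⟨_, hx.nilpotentSum hn' hy, fun q => ?_⟩
    have := nilpotentSum_mem (isolator N) hxN hyN n q
    exact nilpotentSum_map (Rat.castHom ℝ) x y n q ▸ this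
  | smul a X _ hX =>
    obtain ⟨x, hx, hxN⟩ := hX
    exact ⟨_, hx.smul a, fun q => by exact_mod_cast hxN (a * q)⟩

theorem radicableHull_subset_isolator [Group.IsNilpotent G] (N : Subgroup G) :
    radicableHull 𝓘(ℝ, E) N ⊆ (isolator N : Set G) := by
  rintro g ⟨X, hX, γ, h0, hγ, rfl⟩
  obtain ⟨x, hx, hxN⟩ := exists_isOneParameter_of_mem_rationalLieAlgebra N hX
  rw [IsOneParameter.unique ⟨h0, hγ⟩ hx]
  exact_mod_cast hxN 1

end Hull

/-! ### Finiteness of the image of the roots, and the conclusion. -/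

section Finiteness

/-- The power map has the invertible derivative `M • id` at 1, so the inverse function theorem makes
it injective nearby. -/
theorem exists_nhds_one_pow_eq_one {E : Type*} [NormedAddCommGroup E] [NormedSpace ℝ E]
    [CompleteSpace E] {G : Type*} [Group G] [TopologicalSpace G] [ChartedSpace E G]
    [LieGroup 𝓘(ℝ, E) ∞ G] {M : ℕ} (hM : 0 < M) :
    ∃ W ∈ nhds (1 : G), ∀ u ∈ W, u ^ M = 1 → u = 1 := by
  have hid : HasDerivAtOne (fun u : G => u) (1 : G) (ContinuousLinearMap.id ℝ E) :=
    ⟨rfl, hasMFDerivAt_id _⟩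
  obtain ⟨h1, h2⟩ := hid.pow M
  have hc : ContMDiffAt 𝓘(ℝ, E) 𝓘(ℝ, E) ∞ (fun u : G => u ^ M) 1 := (contMDiff_pow M).contMDiffAt
  let φ := extChartAt 𝓘(ℝ, E) (1 : G)
  have h3 : ContDiffAt ℝ ∞ (φ ∘ (fun u => u ^ M) ∘ φ.symm) (φ 1) := by
    have h := (contMDiffAt_iff.mp hc).2
    simp only [modelWithCornersSelf_coe, Set.range_id, contDiffWithinAt_univ, one_pow] at h
    exact h
  have h4 : HasFDerivAt (φ ∘ (fun u => u ^ M) ∘ φ.symm) (M • ContinuousLinearMap.id ℝ E) (φ 1) := by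
    have h := h2.2
    simp only [writtenInExtChartAt, modelWithCornersSelf_coe, Set.range_id, one_pow] at h
    exact h.hasFDerivAt_of_univ
  have hM0 : (M : ℝ) ≠ 0 := by positivity
  have he : (M • ContinuousLinearMap.id ℝ E) =
      (ContinuousLinearEquiv.smulLeft (Units.mk0 (M : ℝ) hM0) : E ≃L[ℝ] E) := by
    ext v
    simp [← Nat.cast_smul_eq_nsmul ℝ, Units.smul_def]
  rw [he] at h4
  have hs := h3.hasStrictFDerivAt' h4 (by simp)
  have hφ := (continuousAt_extChartAt (I := 𝓘(ℝ, E)) (1 : G)).eventually hs.eventually_left_inverse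
  refine ⟨_, Filter.inter_mem hφ (extChartAt_source_mem_nhds (I := 𝓘(ℝ, E)) (1 : G)), ?_⟩
  rintro u ⟨hu, hus⟩ hu1
  have h1s := mem_extChartAt_source (I := 𝓘(ℝ, E)) (1 : G)
  have h5 := hs.eventually_left_inverse.self_of_nhds
  refine φ.injOn hus h1s ?_
  change hs.localInverse _ _ _ (φ (φ.symm (φ u) ^ M)) = φ u at hu
  change hs.localInverse _ _ _ (φ (φ.symm (φ 1) ^ M)) = φ 1 at h5
  rw [φ.left_inv hus, hu1] at hu
  rw [φ.left_inv h1s, one_pow] at h5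
  exact hu.symm.trans h5

/-- Finitely many images of translates `V * a` cover the compact quotient, and each contains at most
one coset of a root. -/
theorem finite_nilProj_image_roots {G : Type*} [Group G] [TopologicalSpace G] [IsTopologicalGroup G]
    [Group.IsNilpotent G] {N : Subgroup G} (hN : IsCocompactLattice N)
    (hG : ∀ M : ℕ, 0 < M → ∃ W ∈ nhds (1 : G), ∀ u ∈ W, u ^ M = 1 → u = 1) {m : ℕ} (hm : 0 < m) :
    (nilProj N '' {h | h ^ m ∈ N}).Finite := by
  obtain ⟨M, hM, hroot⟩ := exists_pow_mem_of_mem_closure G hm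
  obtain ⟨W, hW, hW1⟩ := hG M hM
  have := hN.discrete
  have := hN.compact
  -- `U` meets `N` only in 1: an `M`-th power that lies in both is 1, and then so is its root in
  -- `W`.
  obtain ⟨U, hU, hUN⟩ := isOpen_induced_iff.mp (isOpen_discrete ({1} : Set N))
  have hU1 : (1 : G) ∈ U := (hUN ▸ rfl : (1 : N) ∈ Subtype.val ⁻¹' U)
  have hV : W ∩ (fun u => u ^ M) ⁻¹' U ∈ nhds (1 : G) :=
    Filter.inter_mem hW ((continuous_pow M).continuousAt.preimage_mem_nhds
      (hU.mem_nhds (by simpa using hU1)))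
  have hroots : ∀ u ∈ W ∩ (fun u => u ^ M) ⁻¹' U, u ^ M ∈ N → u = 1 := fun u hu huN =>
    hW1 u hu.1 (congrArg Subtype.val (hUN ▸ hu.2 : (⟨u ^ M, huN⟩ : N) ∈ ({1} : Set N)))
  obtain ⟨V, hVo, hV1, hVV⟩ : ∃ V : Set G, IsOpen V ∧ 1 ∈ V ∧
      ∀ v ∈ V, ∀ w ∈ V, v * w⁻¹ ∈ W ∩ (fun u => u ^ M) ⁻¹' U := by
    have : Filter.Tendsto (fun p : G × G => p.1 * p.2⁻¹) (nhds (1, 1)) (nhds 1) := by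
      have : Continuous (fun p : G × G => p.1 * p.2⁻¹) := by fun_prop
      simpa using this.tendsto (1, 1)
    have := this hV
    rw [nhds_prod_eq] at this
    obtain ⟨V, hV, h⟩ := Filter.mem_prod_same_iff.mp this
    obtain ⟨V', hV', ho, h1⟩ := mem_nhds_iff.mp hV
    exact ⟨V', ho, h1, fun v hv w hw => h (Set.mk_mem_prod (hV' hv) (hV' hw))⟩
  have hopen : IsOpenMap (nilProj N) := isOpenMap_quotient_mk'_mul (Γ := N) (T := G)
  obtain ⟨t, ht⟩ := isCompact_univ.elim_finite_subcover
    (fun a : G => nilProj N '' ((fun v => v * a) '' V))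
    (fun a => hopen _ ((isOpenMap_mul_right a) _ hVo)) (fun x _ => by
      obtain ⟨a, rfl⟩ := Quotient.exists_rep x
      exact Set.mem_iUnion.mpr ⟨a, a, ⟨1, hV1, one_mul a⟩, rfl⟩)
  have hsub : ∀ a : G, (nilProj N '' {h | h ^ m ∈ N} ∩
      nilProj N '' ((fun v => v * a) '' V)).Subsingleton := by
    rintro a _ ⟨⟨h, hh, rfl⟩, ⟨_, ⟨v, hv, rfl⟩, e⟩⟩ _ ⟨⟨k, hk, rfl⟩, ⟨_, ⟨w, hw, rfl⟩, e'⟩⟩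
    have e1 : h * (v * a)⁻¹ ∈ N := QuotientGroup.rightRel_apply.mp (Quotient.exact e)
    have e2 : k * (w * a)⁻¹ ∈ N := QuotientGroup.rightRel_apply.mp (Quotient.exact e')
    have h1 : v * w⁻¹ = (h * (v * a)⁻¹)⁻¹ * h * (k⁻¹ * (k * (w * a)⁻¹)) := by group
    -- Elements of `N` are themselves `m`-th roots of elements of `N`, so all factors in `h1` lie in
    -- this closure.
    have hmem : v * w⁻¹ ∈ Subgroup.closure {h | h ^ m ∈ N} := by
      have hsub : ∀ g, g ^ m ∈ N → g ∈ Subgroup.closure {h | h ^ m ∈ N} := fun g hg =>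
        Subgroup.subset_closure hg
      rw [h1]
      exact mul_mem (mul_mem (inv_mem (hsub _ (N.pow_mem e1 m))) (hsub _ hh))
        (mul_mem (inv_mem (hsub _ hk)) (hsub _ (N.pow_mem e2 m)))
    have h2 := hroots _ (hVV v hv w hw) (hroot N _ (fun _ h => h) _ hmem)
    rw [mul_inv_eq_one] at h2
    rw [← e, ← e', h2]
  refine (t.finite_toSet.biUnion fun a _ => (hsub a).finite).subset fun x hx => ?_
  obtain ⟨a, ha, hxa⟩ := Set.mem_iUnion₂.mp (ht (Set.mem_univ x))
  exact Set.mem_iUnion₂.mpr ⟨a, ha, hx, hxa⟩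

theorem mem_ePer_of_finite {X : Type*} {f : X → X} {A : Set X} (hA : A.Finite)
    (hf : Set.MapsTo f A A) {x : X} (hx : x ∈ A) : x ∈ ePer f := by
  obtain ⟨i, j, hij, h⟩ := hA.exists_lt_map_eq_of_forall_mem (f := fun k : ℕ => f^[k] x)
    (fun k => hf.iterate k hx)
  -- The repetition may occur at `i = 0`, while `ePer` asks for a positive number of steps; hence `i
  -- + 1`.
  refine ⟨i + 1, i.succ_pos, j - i, by omega, ?_⟩
  change f^[j - i] (f^[i + 1] x) = f^[i + 1] x
  rw [← Function.iterate_add_apply, show j - i + (i + 1) = j + 1 by omega,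
    Function.iterate_succ_apply', Function.iterate_succ_apply']
  exact congrArg f h.symm

end Finiteness

theorem mainTheorem5
    {E : Type*} [NormedAddCommGroup E] [NormedSpace ℝ E] [FiniteDimensional ℝ E]
    {G : Type*} [Group G] [TopologicalSpace G] [ChartedSpace E G] [LieGroup 𝓘(ℝ, E) ∞ G]
    [T2Space G] [SimplyConnectedSpace G] [Group.IsNilpotent G]
    (N : Subgroup G) (hN : IsCocompactLattice N)
    (δ : G ≃ₜ* G) (hδ : ∀ n ∈ N, δ n ∈ N) :
    nilProj N '' radicableHull 𝓘(ℝ, E) N ⊆ ePer (nilEndomorphism N δ hδ) := by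
  have : IsTopologicalGroup G := topologicalGroup_of_lieGroup 𝓘(ℝ, E) ∞
  have : CompleteSpace E := FiniteDimensional.complete ℝ E
  rintro _ ⟨g, hg, rfl⟩
  obtain ⟨m, hm, hgm⟩ := radicableHull_subset_isolator N hg
  refine mem_ePer_of_finite (finite_nilProj_image_roots hN
    (fun M hM => exists_nhds_one_pow_eq_one (E := E) hM) hm) ?_ ⟨g, hgm, rfl⟩
  rintro _ ⟨h, hh, rfl⟩
  exact ⟨δ h, by simpa using hδ _ hh, rfl⟩
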